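/- Let $M$ be a smooth manifold of dimension $2n+1$ with a globally defined contact form $\theta$ (a smooth nowhere vanishing $1$-form such that $\omega=d\theta|_{\mathcal C}$ is non-degenerate on each hyperplane $\mathcal C_m=\ker\theta_m$), and let $M^{(1)}$ be the set of all Lagrangian planes $L\subset\mathcal C_m$, $m\in M$ (the $n$-dimensional $\omega_m$-isotropic subspaces). Let $\mathcal D\subset\mathcal C$ be a smooth distribution of rank $n$, let $\mathcal D^\perp$ be its $\omega$-orthogonal complement in $\mathcal C$, and put $$\mathcal E_{\mathcal D}=\{L\in M^{(1)} : L\subset \mathcal C_m,\ m\in M,\ L\cap\mathcal D_m\neq 0\}.$$ Suppose that $\mathcal D^\perp$ has $n$ first integrals $f_1,\dots,f_n\in C^\infty(M)$ (that is, $df_i|_{\mathcal D^\perp}=0$) which are independent in the sense that the covectors $\theta_m,(df_1)_m,\dots,(df_n)_m$ are linearly independent at every $m\in M$ (equivalently, the Hamiltonian fields $Y_{f_1},\dots,Y_{f_n}$ are linearly independent at every point). Then $$\bigcup_{\varphi}M^{(1)}_{\varphi(f_1,\dots,f_n)}=\mathcal E_{\mathcal D},$$ where $\varphi$ runs over all functions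 in $C^\infty(\mathbb R^n)$. Here $M_f=\{f=0\}$, and for a subset $S\subset M$ the prolongation $S^{(1)}$ is the set of Lagrangian planes $L\subset T_mS\cap\mathcal C_m$, where $m$ runs over the points of $S$ near which $S$ is a smooth hypersurface of $M$ (so $S^{(1)}$ is the usual prolongation if $S$ is a hypersurface). -/

import Mathlib

open scoped Manifold ContDiff Bundle

noncomputable section

namespace ContactGeometry

/-- The model vector space of a manifold of dimension `2n + 1`. -/
abbrev Model (n : ℕ) : Type := EuclideanSpace ℝ (Fin (2 * n + 1))

variable {n : ℕ} {M : Type*} [TopologicalSpace M] [ChartedSpace (Model n) M]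

/-- The tangent space `T_m M`. -/
abbrev Tan (n : ℕ) {M : Type*} [TopologicalSpace M] [ChartedSpace (Model n) M] (m : M) : Type :=
  TangentSpace (𝓡 (2 * n + 1)) m

/-- A (not necessarily smooth) differential 1-form on `M`. -/
abbrev OneForm (n : ℕ) (M : Type*) [TopologicalSpace M] [ChartedSpace (Model n) M] : Type _ :=
  (m : M) → Tan n m →L[ℝ] ℝ

/-- A 1-form is smooth if it is a smooth section of the bundle `Hom(TM, ℝ)`. -/
def OneForm.IsSmooth [IsManifold (𝓡 (2 * n + 1)) ∞ M] (θ : OneForm n M) : Prop :=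
  ContMDiff (𝓡 (2 * n + 1)) ((𝓡 (2 * n + 1)).prod 𝓘(ℝ, Model n →L[ℝ] ℝ)) ∞
    (fun m : M => (Bundle.TotalSpace.mk' (Model n →L[ℝ] ℝ)
      (E := fun x : M => Tan n x →L[ℝ] Bundle.Trivial M ℝ x) m (θ m)))

/-- The coordinate expression of a 1-form in the preferred chart at `m₀`: the pullback of `θ` along
the inverse of the chart, a 1-form on the model space (meaningful on the target of the chart). -/
def OneForm.inChart (θ : OneForm n M) (m₀ : M) (y : Model n) : Model n [⋀^Fin 1]→L[ℝ] ℝ :=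
  ContinuousAlternatingMap.ofSubsingleton ℝ (Model n) ℝ (0 : Fin 1)
    ((θ ((extChartAt (𝓡 (2 * n + 1)) m₀).symm y)).comp
      (mfderiv 𝓘(ℝ, Model n) (𝓡 (2 * n + 1)) (extChartAt (𝓡 (2 * n + 1)) m₀).symm y))

/-- The exterior derivative `dθ` at `m`: take the exterior derivative of the coordinate expression
of `θ` in the chart at `m`, and pull it back to `T_m M` along the chart. -/
def OneForm.d (θ : OneForm n M) (m : M) : Tan n m [⋀^Fin 2]→L[ℝ] ℝ :=
  (extDeriv (θ.inChart m) (extChartAt (𝓡 (2 * n + 1)) m m)).compContinuousLinearMap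
    (mfderiv (𝓡 (2 * n + 1)) 𝓘(ℝ, Model n) (extChartAt (𝓡 (2 * n + 1)) m) m)

/-- The hyperplane `𝒞_m = ker θ_m`. -/
def contactPlane (θ : OneForm n M) (m : M) : Submodule ℝ (Tan n m) :=
  LinearMap.ker (θ m).toLinearMap

/-- `θ` is a contact form on the `(2n+1)`-dimensional manifold `M`: it is smooth, it vanishes
nowhere, and `dθ` is non-degenerate on each hyperplane `𝒞_m = ker θ_m`
(that is, `𝒞 = ker θ` is completely non-integrable). -/
structure IsContactForm [IsManifold (𝓡 (2 * n + 1)) ∞ M] (θ : OneForm n M) : Prop where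
  smooth : θ.IsSmooth
  ne_zero : ∀ m, θ m ≠ 0
  nondegenerate : ∀ m, ∀ v ∈ contactPlane θ m,
    (∀ w ∈ contactPlane θ m, θ.d m ![v, w] = 0) → v = 0

/-- `𝒟` is a smooth distribution of rank `k` on `M`. -/
structure IsDistribution [IsManifold (𝓡 (2 * n + 1)) ∞ M] (k : ℕ)
    (𝒟 : (m : M) → Submodule ℝ (Tan n m)) : Prop where
  finrank_eq : ∀ m, Module.finrank ℝ (𝒟 m) = k
  smooth : ∀ m, ∃ U : Set M, IsOpen U ∧ m ∈ U ∧ ∃ X : Fin k → (x : M) → Tan n x,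
    (∀ i, ContMDiffOn (𝓡 (2 * n + 1)) (𝓡 (2 * n + 1)).tangent ∞
      (fun x => (⟨x, X i x⟩ : TangentBundle (𝓡 (2 * n + 1)) M)) U) ∧
    ∀ x ∈ U, 𝒟 x = Submodule.span ℝ (Set.range fun i => X i x)

/-- The orthogonal complement in `𝒞_m` of a subspace `D`, with respect to the
symplectic form `ω = dθ|_𝒞`. -/
def orthogonal (θ : OneForm n M) (m : M) (D : Submodule ℝ (Tan n m)) :
    Submodule ℝ (Tan n m) where
  carrier := {v | v ∈ contactPlane θ m ∧ ∀ w ∈ D, θ.d m ![v, w] = 0}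
  zero_mem' := ⟨Submodule.zero_mem _, fun w _ => (θ.d m).map_coord_zero 0 rfl⟩
  add_mem' := fun {a b} ha hb => ⟨Submodule.add_mem _ ha.1 hb.1, fun w hw => by
    have h := (θ.d m).toMultilinearMap.cons_add ![w] a b
    exact h.trans ((congrArg₂ (· + ·) (ha.2 w hw) (hb.2 w hw)).trans (add_zero 0))⟩
  smul_mem' := fun c a ha => ⟨Submodule.smul_mem _ c ha.1, fun w hw => by
    have h := (θ.d m).toMultilinearMap.cons_smul ![w] c a
    exact h.trans ((congrArg (c • ·) (ha.2 w hw)).trans (smul_zero c))⟩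

/-- The prolongation `M⁽¹⁾` of the contact manifold `(M, ker θ)`: its points are the Lagrangian
planes of `(𝒞_m, ω_m)`, `m ∈ M`. -/
structure Prolongation (θ : OneForm n M) where
  /-- the base point `m = π(m¹)` -/
  base : M
  /-- the Lagrangian plane `L_{m¹} ⊆ 𝒞_m` -/
  plane : Submodule ℝ (Tan n base)
  le_contactPlane : plane ≤ contactPlane θ base
  finrank_eq : Module.finrank ℝ plane = n
  isotropic : ∀ v ∈ plane, ∀ w ∈ plane, θ.d base ![v, w] = 0

/-- The equation `ℰ_𝒟`: Lagrangian planes that meet `𝒟` non-trivially. -/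
def goursatEquation (θ : OneForm n M) (𝒟 : (m : M) → Submodule ℝ (Tan n m)) :
    Set (Prolongation θ) :=
  {L | L.plane ⊓ 𝒟 L.base ≠ ⊥}

/-- The differential `df_m` of a real function. -/
def differential (f : M → ℝ) (m : M) : Tan n m →L[ℝ] ℝ :=
  mfderiv (𝓡 (2 * n + 1)) 𝓘(ℝ, ℝ) f m

/-- `f ∈ C^∞(M)` is a first integral of the distribution `𝒟`: `X(f) = 0` for `X ∈ 𝒟`. -/
def IsFirstIntegral (𝒟 : (m : M) → Submodule ℝ (Tan n m)) (f : M → ℝ) : Prop :=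
  ContMDiff (𝓡 (2 * n + 1)) 𝓘(ℝ, ℝ) ∞ f ∧ ∀ m, ∀ v ∈ 𝒟 m, differential f m v = 0

/-- The functions `f i` are independent on the contact manifold: at every point `m` the covectors
`θ_m, d(f₁)_m, …, d(f_k)_m` are linearly independent. (Equivalently, the restrictions of the
`df_i` to `𝒞`, or the Hamiltonian fields `Y_{f_i}`, are linearly independent at every point.) -/
def AreIndependent (θ : OneForm n M) {k : ℕ} (f : Fin k → M → ℝ) : Prop :=
  ∀ m, LinearIndependent ℝ
    (Fin.cons (θ m) (fun i => differential (f i) m) : Fin (k + 1) → Tan n m →L[ℝ] ℝ)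

/-- Near its point `m`, the set `S` is a smooth hypersurface with local equation `g = 0`,
`dg_m ≠ 0`. The tangent space `T_m S` is then `ker dg_m`, for any such `g`. -/
def IsLocalEquation (S : Set M) (m : M) (g : M → ℝ) : Prop :=
  m ∈ S ∧ differential (n := n) g m ≠ 0 ∧
    ∃ U : Set M, IsOpen U ∧ m ∈ U ∧ ContMDiffOn (𝓡 (2 * n + 1)) 𝓘(ℝ, ℝ) ∞ g U ∧
      ∀ x ∈ U, x ∈ S ↔ g x = 0

/-- The prolongation `S⁽¹⁾` of a hypersurface `S ⊆ M`: the Lagrangian planes `L ⊆ 𝒞_m`, `m ∈ S`,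
contained in `T_m S ∩ 𝒞_m`. If `S` is not a hypersurface near some of its points,
such points do not contribute. -/
def hypersurfaceProlongation (θ : OneForm n M) (S : Set M) : Set (Prolongation θ) :=
  {L | ∃ g : M → ℝ, IsLocalEquation (n := n) S L.base g ∧
    L.plane ≤ LinearMap.ker (differential g L.base).toLinearMap ⊓ contactPlane θ L.base}

/-- The zero level set `M_f`. -/
def zeroLevel (f : M → ℝ) : Set M := {m | f m = 0}

end ContactGeometry

end

/-! Everything reduces to linear algebra at one point. The vectors `X i` that are `ω`-dual to the
restrictions of the `df_i` to `𝒞` lie in `(𝒟^⊥)^⊥ = 𝒟`; independence and a dimension count make them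
a basis of `𝒟`. Since a Lagrangian `L` equals its own orthogonal, `∑ c_i X_i ∈ L` exactly when `∑
c_i df_i` vanishes on `L`. So `L` meets `𝒟` iff some non-trivial combination of the `df_i` kills `L`
(`ContinuousAlternatingMap.inf_ne_bot_iff_exists_sum_eq_zero`). Such a combination is the
differential of an affine `φ(f)`. Conversely, a local equation `g` of a level set of `φ(f)` need not
be related to `φ(f)` itself, whose differential may vanish there. But `g` is zero on the joint level
set of the `f_i` near the point, so Lagrange multipliers put `dg` in the span of the `df_i`
(`IsLocalEquation.exists_differential_eq_sum`). -/

open Module in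
/-- In a symplectic space `W`, let `D` and `L` have half dimension, with `L` isotropic, and let
`a` be a basis of the annihilator of the orthogonal complement of `D`. Then `L` meets `D`
non-trivially if and only if some non-trivial combination of the `a i` vanishes on `L`. -/
theorem LinearMap.BilinForm.inf_ne_bot_iff_exists_sum_eq_zero {n : ℕ} {W : Type*} [AddCommGroup W]
    [Module ℝ W] [FiniteDimensional ℝ W] (B : LinearMap.BilinForm ℝ W) (hB : B.Nondegenerate)
    (hrefl : B.IsRefl) (hW : finrank ℝ W = 2 * n) (D L : Submodule ℝ W)
    (hD : finrank ℝ D = n) (hL : finrank ℝ L = n) (hiso : L ≤ B.orthogonal L)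
    (a : Fin n → Dual ℝ W) (ha : LinearIndependent ℝ a)
    (haD : ∀ i, ∀ w ∈ B.orthogonal D, a i w = 0) :
    L ⊓ D ≠ ⊥ ↔ ∃ c : Fin n → ℝ, c ≠ 0 ∧ ∀ w ∈ L, ∑ i, c i * a i w = 0 := by
  -- The Hamiltonian vectors of the covectors `a i`.
  set X : Fin n → W := fun i => (B.toDual hB).symm (a i) with hXdef
  have hX : LinearIndependent ℝ X :=
    ha.map' (B.toDual hB).symm.toLinearMap (LinearEquiv.ker _)
  have hBX (i : Fin n) (w : W) : B (X i) w = a i w := by simp [hXdef]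
  have hXD (i : Fin n) : X i ∈ D := by
    rw [← B.orthogonal_orthogonal hB hrefl D]
    exact fun w hw => hrefl _ _ ((hBX i w).trans (haD i w hw))
  have hspan : Submodule.span ℝ (Set.range X) = D := by
    refine Submodule.eq_of_le_of_finrank_eq (Submodule.span_le.2 ?_) ?_
    · rintro _ ⟨i, rfl⟩
      exact hXD i
    · rw [finrank_span_eq_card hX, hD, Fintype.card_fin]
  have hLag : L = B.orthogonal L :=
    Submodule.eq_of_le_of_finrank_eq hiso (by rw [B.finrank_orthogonal hB, hW, hL]; omega)
  have hsum (c : Fin n → ℝ) (w : W) : B (∑ i, c i • X i) w = ∑ i, c i * a i w := by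
    simp [hBX, LinearMap.sum_apply]
  constructor
  · intro h
    obtain ⟨v, hv, hv0⟩ := Submodule.exists_mem_ne_zero_of_ne_bot h
    have hvD := hv.2
    rw [SetLike.mem_coe, ← hspan, Submodule.mem_span_range_iff_exists_fun] at hvD
    obtain ⟨c, rfl⟩ := hvD
    refine ⟨c, ?_, fun w hw => ?_⟩
    · rintro rfl
      simp at hv0
    · rw [← hsum]
      exact hrefl _ _ (hiso hv.1 w hw)
  · rintro ⟨c, hc, hcL⟩
    refine Submodule.ne_bot_iff _ |>.2 ⟨∑ i, c i • X i, ⟨?_, ?_⟩, fun h => hc ?_⟩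
    · rw [hLag]
      exact fun w hw => hrefl _ _ ((hsum c w).trans (hcL w hw))
    · exact D.sum_mem fun i _ => D.smul_mem _ (hXD i)
    · exact funext (Fintype.linearIndependent_iff.1 hX c h)

/-- The bilinear form `(v, w) ↦ Ω(v, w)` of an alternating 2-form. -/
def ContinuousAlternatingMap.toBilinForm {V : Type*} [AddCommGroup V] [Module ℝ V]
    [TopologicalSpace V] (Ω : V [⋀^Fin 2]→L[ℝ] ℝ) : LinearMap.BilinForm ℝ V :=
  LinearMap.mk₂ ℝ (fun v w => Ω ![v, w])
    (fun v v' w => Ω.toAlternatingMap.map_vecCons_add ![w] v v')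
    (fun c v w => Ω.toAlternatingMap.map_vecCons_smul ![w] c v)
    (fun v w w' => by
      have h (x : V) : Function.update ![v, w] 1 x = ![v, x] := by
        ext i; fin_cases i <;> rfl
      simpa only [h] using Ω.map_update_add ![v, w] 1 w w')
    (fun c v w => by
      have h (x : V) : Function.update ![v, w] 1 x = ![v, x] := by
        ext i; fin_cases i <;> rfl
      simpa only [h] using Ω.map_update_smul ![v, w] 1 c w)

theorem ContinuousAlternatingMap.toBilinForm_isAlt {V : Type*} [AddCommGroup V] [Module ℝ V]
    [TopologicalSpace V] (Ω : V [⋀^Fin 2]→L[ℝ] ℝ) : Ω.toBilinForm.IsAlt :=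
  fun v => Ω.map_eq_zero_of_eq ![v, v] (i := 0) (j := 1) rfl (by simp)

/-- If `t` and the covectors `a i` are linearly independent, then so are the restrictions of the
`a i` to the kernel of `t`. -/
theorem LinearIndependent.domRestrict_ker {n : ℕ} {V : Type*} [AddCommGroup V] [Module ℝ V]
    [TopologicalSpace V] {t : V →L[ℝ] ℝ} {a : Fin n → V →L[ℝ] ℝ}
    (h : LinearIndependent ℝ (Fin.cons t a : Fin (n + 1) → V →L[ℝ] ℝ)) :
    LinearIndependent ℝ
      fun i => (a i).toLinearMap.domRestrict (LinearMap.ker t.toLinearMap) := by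
  rw [Fintype.linearIndependent_iff]
  intro c hc
  have hker : ∀ v, t v = 0 → (∑ i, c i • a i) v = 0 := fun v hv => by
    simpa [LinearMap.sum_apply, sum_apply] using
      LinearMap.congr_fun hc ⟨v, hv⟩
  -- A covector vanishing on `ker t` is a multiple of `t`, which turns a relation on the kernel into
  -- one on `V`.
  obtain ⟨s, hs⟩ := Submodule.mem_span_singleton.1 <| by
    simpa using mem_span_of_iInf_ker_le_ker (ι := Unit) (L := fun _ => t.toLinearMap)
      (K := (∑ i, c i • a i : V →L[ℝ] ℝ).toLinearMap) (fun v hv => hker v (by simpa using hv))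
  have hz : (-s) • t + ∑ i, c i • a i = 0 := by
    ext v
    have := LinearMap.congr_fun hs v
    simp only [LinearMap.smul_apply, LinearMap.sum_apply, ContinuousLinearMap.coe_coe,
      smul_eq_mul] at this
    simp [this]
  intro i
  have := Fintype.linearIndependent_iff.1 h (Fin.cons (-s) c) (by
    rw [Fin.sum_univ_succ]; simpa only [Fin.cons_zero, Fin.cons_succ] using hz) i.succ
  simpa using this

open Module in
/-- Pointwise form of the main theorem: a Lagrangian plane of `ker t` meets `D` if and only if a
non-trivial combination of the covectors `a i` vanishes on it. -/
theorem ContinuousAlternatingMap.inf_ne_bot_iff_exists_sum_eq_zero {n : ℕ} {V : Type*}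
    [AddCommGroup V] [Module ℝ V] [TopologicalSpace V] [FiniteDimensional ℝ V]
    (hV : finrank ℝ V = 2 * n + 1) (t : V →L[ℝ] ℝ) (ht : t ≠ 0) (Ω : V [⋀^Fin 2]→L[ℝ] ℝ)
    (hΩ : ∀ v, t v = 0 → (∀ w, t w = 0 → Ω ![v, w] = 0) → v = 0) (D L : Submodule ℝ V)
    (hDt : D ≤ LinearMap.ker t.toLinearMap) (hLt : L ≤ LinearMap.ker t.toLinearMap)
    (hD : finrank ℝ D = n) (hL : finrank ℝ L = n)
    (hiso : ∀ v ∈ L, ∀ w ∈ L, Ω ![v, w] = 0) (a : Fin n → V →L[ℝ] ℝ)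
    (ha : LinearIndependent ℝ (Fin.cons t a : Fin (n + 1) → V →L[ℝ] ℝ))
    (haD : ∀ i v, t v = 0 → (∀ w ∈ D, Ω ![v, w] = 0) → a i v = 0) :
    L ⊓ D ≠ ⊥ ↔ ∃ c : Fin n → ℝ, c ≠ 0 ∧ ∀ w ∈ L, ∑ i, c i * a i w = 0 := by
  set C := LinearMap.ker t.toLinearMap
  set B : LinearMap.BilinForm ℝ C := Ω.toBilinForm.restrict C
  have hrefl₀ := Ω.toBilinForm_isAlt.isRefl
  have hrefl : B.IsRefl := fun v w h => hrefl₀ v w h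
  have hB : B.Nondegenerate := by
    refine (LinearMap.IsRefl.nondegenerate_iff_separatingLeft hrefl).2 ?_
    exact fun v hv => Subtype.ext (hΩ v v.2 fun w hw => hv ⟨w, hw⟩)
  have hdim : finrank ℝ C = 2 * n := by
    have h := LinearMap.finrank_range_add_finrank_ker t.toLinearMap
    have h0 : t.toLinearMap ≠ 0 := fun h0 => ht (ContinuousLinearMap.coe_injective h0)
    rw [LinearMap.range_eq_top.2 (LinearMap.surjective h0), finrank_top, finrank_self, hV] at h
    change 1 + finrank ℝ C = 2 * n + 1 at h
    omega
  have key := B.inf_ne_bot_iff_exists_sum_eq_zero hB hrefl hdim (D.comap C.subtype)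
    (L.comap C.subtype)
    ((LinearEquiv.finrank_eq (Submodule.comapSubtypeEquivOfLe hDt)).trans hD)
    ((LinearEquiv.finrank_eq (Submodule.comapSubtypeEquivOfLe hLt)).trans hL)
    (fun v hv w hw => hiso w hw v hv) _ ha.domRestrict_ker
    -- `B.orthogonal` puts the elements of `D` in the left slot, `haD` in the right one; reflexivity
    -- exchanges them.
    (fun i v hv => haD i v v.2 fun w hw => hrefl₀ w v (hv ⟨w, hDt hw⟩ hw))
  rw [← Submodule.comap_inf] at key
  -- Pulling back to `C` loses nothing, because `L ⊓ D` lies in `C`.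
  have hbot : (L ⊓ D).comap C.subtype = ⊥ ↔ L ⊓ D = ⊥ := by
    rw [← Submodule.disjoint_iff_comap_eq_bot, disjoint_iff,
      inf_eq_right.2 (inf_le_left.trans hLt)]
  rw [ne_eq, ← hbot]
  refine key.trans (exists_congr fun c => and_congr_right fun _ => ?_)
  exact ⟨fun h w hw => h ⟨w, hLt hw⟩ hw, fun h w hw => h w hw⟩

namespace ContactGeometry

variable {n : ℕ} {M : Type*} [TopologicalSpace M] [ChartedSpace (Model n) M]

instance (m : M) : FiniteDimensional ℝ (Tan n m) :=
  inferInstanceAs (FiniteDimensional ℝ (Model n))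

theorem finrank_tan (m : M) : Module.finrank ℝ (Tan n m) = 2 * n + 1 :=
  finrank_euclideanSpace_fin

/-- In the preferred chart at `m`, a function smooth at `m` is strictly differentiable, with
derivative its differential at `m`. -/
theorem hasStrictFDerivAt_differential {g : M → ℝ} {m : M}
    (hg : ContMDiffAt (𝓡 (2 * n + 1)) 𝓘(ℝ, ℝ) ∞ g m) :
    HasStrictFDerivAt (𝕜 := ℝ) (E := Model n) (g ∘ (extChartAt (𝓡 (2 * n + 1)) m).symm)
      (differential (n := n) g m) (extChartAt (𝓡 (2 * n + 1)) m m) := by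
  have h := (contMDiffAt_iff.1 hg).2
  rw [modelWithCornersSelf_coe, Set.range_id, contDiffWithinAt_univ] at h
  have h' : ContDiffAt ℝ ∞ (g ∘ (extChartAt (𝓡 (2 * n + 1)) m).symm)
    (extChartAt (𝓡 (2 * n + 1)) m m) := h
  have heq : differential (n := n) g m = fderiv ℝ (g ∘ (extChartAt (𝓡 (2 * n + 1)) m).symm)
      (extChartAt (𝓡 (2 * n + 1)) m m) := by
    have hd : MDifferentiableAt (𝓡 (2 * n + 1)) 𝓘(ℝ, ℝ) g m := hg.mdifferentiableAt (by simp)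
    rw [differential, hd.mfderiv, modelWithCornersSelf_coe, Set.range_id, fderivWithin_univ]
    rfl
  rw [heq]
  exact h'.hasStrictFDerivAt (by simp)

/-- A local equation of a set which is a union of level sets of independent functions `f i` has
differential in the span of the `df i`. -/
theorem IsLocalEquation.exists_differential_eq_sum {k : ℕ} {f : Fin k → M → ℝ} {S : Set M} {m : M}
    {g : M → ℝ} (hf : ∀ i, ContMDiffAt (𝓡 (2 * n + 1)) 𝓘(ℝ, ℝ) ∞ (f i) m)
    (hind : LinearIndependent ℝ fun i => differential (n := n) (f i) m)
    (hS : ∀ x, (∀ i, f i x = f i m) → x ∈ S) (hg : IsLocalEquation (n := n) S m g) :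
    ∃ c : Fin k → ℝ, differential (n := n) g m = ∑ i, c i • differential (f i) m := by
  obtain ⟨hm, -, U, hU, hmU, hgU, hSU⟩ := hg
  set e := extChartAt (𝓡 (2 * n + 1)) m
  have hem : e.symm (e m) = m := extChartAt_to_inv m
  have hcont : Filter.Tendsto e.symm (nhds (e m)) (nhds m) := by
    have := continuousAt_extChartAt_symm (I := 𝓡 (2 * n + 1)) m
    rwa [ContinuousAt, hem] at this
  -- On the joint level set `g` is locally constant, hence trivially extremal.
  have hextr : IsLocalExtrOn (g ∘ e.symm)
      {y | ∀ i, (f i ∘ e.symm) y = (f i ∘ e.symm) (e m)} (e m) := by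
    refine Or.inl ?_
    filter_upwards [nhdsWithin_le_nhds (hcont (hU.mem_nhds hmU)), self_mem_nhdsWithin]
      with y hyU hy
    have h1 : g (e.symm y) = 0 := (hSU _ hyU).1 (hS _ fun i => by simpa [hem] using hy i)
    have h2 : g m = 0 := (hSU m hmU).1 hm
    simp [hem, h1, h2]
  obtain ⟨Λ, Λ₀, hne, hsum⟩ := hextr.exists_multipliers_of_hasStrictFDerivAt
    (fun i => hasStrictFDerivAt_differential (hf i))
    (hasStrictFDerivAt_differential (hgU.contMDiffAt (hU.mem_nhds hmU)))
  replace hsum : ∑ i, Λ i • differential (n := n) (f i) m + Λ₀ • differential (n := n) g m = 0 :=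
    hsum
  -- The constraints are regular, so the multiplier of `g` cannot vanish.
  have hΛ₀ : Λ₀ ≠ 0 := by
    rintro rfl
    rw [zero_smul, add_zero] at hsum
    exact hne (Prod.ext (funext (Fintype.linearIndependent_iff.1 hind Λ hsum)) rfl)
  refine ⟨fun i => -(Λ₀⁻¹ * Λ i), ?_⟩
  have h : Λ₀ • differential (n := n) g m = -∑ i, Λ i • differential (f i) m :=
    eq_neg_of_add_eq_zero_right hsum
  calc differential (n := n) g m = Λ₀⁻¹ • Λ₀ • differential (n := n) g m :=
        (inv_smul_smul₀ hΛ₀ _).symm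
    _ = _ := by
        rw [h, smul_neg, Finset.smul_sum, ← Finset.sum_neg_distrib]
        exact Finset.sum_congr rfl fun i _ => by
          rw [smul_smul]
          exact (neg_smul _ _).symm

theorem differential_sum_mul_sub {k : ℕ} {f : Fin k → M → ℝ} {m : M}
    (hf : ∀ i, ContMDiffAt (𝓡 (2 * n + 1)) 𝓘(ℝ, ℝ) ∞ (f i) m) (c b : Fin k → ℝ)
    (hg : ContMDiffAt (𝓡 (2 * n + 1)) 𝓘(ℝ, ℝ) ∞ (fun x => ∑ i, c i * (f i x - b i)) m) :
    differential (n := n) (fun x => ∑ i, c i * (f i x - b i)) m =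
      ∑ i, c i • differential (f i) m := by
  set e := extChartAt (𝓡 (2 * n + 1)) m
  -- Retyping the differentials on the model space gives access to the ordinary calculus of
  -- `HasFDerivAt`; uniqueness of the derivative then concludes.
  let f' (i : Fin k) : Model n →L[ℝ] ℝ := differential (n := n) (f i) m
  have hf' (i : Fin k) : HasFDerivAt (f i ∘ e.symm) (f' i) (e m) :=
    (hasStrictFDerivAt_differential (hf i)).hasFDerivAt
  have h : HasFDerivAt (fun y => ∑ i, c i * ((f i ∘ e.symm) y - b i)) (∑ i, c i • f' i) (e m) :=
    HasFDerivAt.fun_sum fun i _ => ((hf' i).sub_const (b i)).const_mul (c i)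
  let g' : Model n →L[ℝ] ℝ := differential (n := n) (fun x => ∑ i, c i * (f i x - b i)) m
  have hg' : HasFDerivAt (fun y => ∑ i, c i * ((f i ∘ e.symm) y - b i)) g' (e m) :=
    (hasStrictFDerivAt_differential hg).hasFDerivAt
  exact hg'.unique h

end ContactGeometry

open ContactGeometry in
theorem mainTheorem11 (n : ℕ) (M : Type*) [TopologicalSpace M] [ChartedSpace (Model n) M]
    [IsManifold (𝓡 (2 * n + 1)) ∞ M]
    (θ : OneForm n M) (hθ : IsContactForm θ)
    (𝒟 : (m : M) → Submodule ℝ (Tan n m)) (h𝒟 : IsDistribution n 𝒟)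
    (h𝒟C : ∀ m, 𝒟 m ≤ contactPlane θ m)
    (f : Fin n → M → ℝ)
    (hf : ∀ i, IsFirstIntegral (fun m => orthogonal θ m (𝒟 m)) (f i))
    (hind : AreIndependent θ f) :
    (⋃ φ ∈ {φ : (Fin n → ℝ) → ℝ | ContDiff ℝ ∞ φ},
      hypersurfaceProlongation θ (zeroLevel fun m => φ fun i => f i m)) =
    goursatEquation θ 𝒟 := by
  have hind' (m : M) : LinearIndependent ℝ fun i => differential (n := n) (f i) m :=
    (hind m).comp Fin.succ (Fin.succ_injective n)
  ext L
  have key : L ∈ goursatEquation θ 𝒟 ↔ ∃ c : Fin n → ℝ, c ≠ 0 ∧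
      ∀ w ∈ L.plane, ∑ i, c i * differential (f i) L.base w = 0 :=
    ContinuousAlternatingMap.inf_ne_bot_iff_exists_sum_eq_zero (finrank_tan L.base)
      (θ L.base) (hθ.ne_zero L.base) (θ.d L.base) (hθ.nondegenerate L.base) (𝒟 L.base) L.plane
      (h𝒟C L.base) L.le_contactPlane (h𝒟.finrank_eq L.base) L.finrank_eq L.isotropic _
      (hind L.base) fun i v hv hvD => (hf i).2 L.base v ⟨hv, hvD⟩
  rw [key]
  simp only [Set.mem_iUnion, exists_prop]
  constructor
  · rintro ⟨φ, -, g, hg, hLg⟩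
    obtain ⟨c, hc⟩ := hg.exists_differential_eq_sum (fun i => (hf i).1 L.base) (hind' L.base)
      fun x hx => by
        have : φ (fun i => f i L.base) = 0 := hg.1
        simpa [zeroLevel, hx] using this
    refine ⟨c, ?_, fun w hw => ?_⟩
    · rintro rfl
      exact hg.2.1 (by simp [hc])
    · have h : differential g L.base w = 0 := (hLg hw).1
      rw [hc] at h
      simpa [sum_apply] using h
  · rintro ⟨c, hc, hcL⟩
    -- The affine function with linear part `c`, normalised to vanish at the values of the `f i` at
    -- the base point.
    have hφ : ContDiff ℝ ∞ fun y : Fin n → ℝ => ∑ i, c i * (y i - f i L.base) := by fun_prop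
    have hF : ContMDiff (𝓡 (2 * n + 1)) 𝓘(ℝ, Fin n → ℝ) ∞ fun x i => f i x :=
      contMDiff_pi_space.2 fun i => (hf i).1
    have hg : ContMDiff (𝓡 (2 * n + 1)) 𝓘(ℝ, ℝ) ∞
        fun x => ∑ i, c i * (f i x - f i L.base) := hφ.contMDiff.comp hF
    have hd := differential_sum_mul_sub (fun i => (hf i).1 L.base) c (fun i => f i L.base)
      (hg L.base)
    refine ⟨_, hφ, fun x => ∑ i, c i * (f i x - f i L.base), ⟨?_, ?_, Set.univ, isOpen_univ,
      trivial, hg.contMDiffOn, fun x _ => Iff.rfl⟩, fun w hw => ⟨?_, L.le_contactPlane hw⟩⟩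
    · simp [zeroLevel]
    · rw [hd]
      exact fun h => hc (funext (Fintype.linearIndependent_iff.1 (hind' L.base) c h))
    · rw [SetLike.mem_coe, LinearMap.mem_ker, hd]
      simpa [sum_apply] using hcL w hw
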